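/- Theorem (Corona type algebras). All Hilbert spaces are complex. For a Banach space $X$ let $\mathcal{B}(X)$ be the Banach algebra of bounded linear operators on $X$, $\mathcal{K}(X)$ the ideal of compact operators, $\mathcal{S}(X)$ the closed two-sided ideal of operators with separable range, and $\mathcal{C}(X)=\mathcal{B}(X)/\mathcal{K}(X)$; quotients carry the quotient norm. Let $\mathcal{G}(x)=\{T(x): T\colon X\to X \text{ is a surjective linear isometry}\}$ be the orbit of $x\in X$, and let $\mathbf{B}_X$ be the closed unit ball of the norm. Given a locally convex topology $\tau$ on $X$ (not necessarily the norm topology), $X$ is called $\tau$-convex-transitive if $\overline{\mathrm{conv}}^{\,\tau}(\mathcal{G}(x))=\mathbf{B}_X$ for every $x\in X$ with $\|x\|=1$, and convex-transitive if this holds for the norm topology. (1) The algebra $\mathcal{B}(\ell^2(\omega_1))/\mathcal{S}(\ell^2(\omega_1))$ is convex-transitive. (2) For every infinite cardinal $\kappa$, the Calkin algebra $\mathcal{C}(\ell^2(\kappa))$ is $\tau$-convex-transitive. Here $\tau$ is the topology of uniform convergence on separable subspaces: on $\mathcal{B}(\ell^2(\kappa))$ it is generated by the sets $$\{T:\ \|T_i|_Y-T|_Y\|_{\mathcal{B}(Y,\ell^2(\kappa))}<\varepsilon,\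 i=1,\dots,n\},$$ where $T_1,\dots,T_n\in\mathcal{B}(\ell^2(\kappa))$, $Y\subset\ell^2(\kappa)$ is a separable linear subspace and $\varepsilon>0$; and on $\mathcal{C}(\ell^2(\kappa))$ it is the corresponding quotient topology, whose open sets are the sets $U+\mathcal{K}(\ell^2(\kappa))$ with $U$ open in $\mathcal{B}(\ell^2(\kappa))$. -/

import Mathlib

open scoped Cardinal

universe u v

/-- The complex Hilbert space `ℓ²(Γ)` of square-summable families indexed by the set `Γ`. -/
abbrev EllTwo (Γ : Type*) : Type _ := lp (fun _ : Γ => ℂ) 2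

/-- The Banach algebra `B(X)` of bounded operators on `X`, with the operator norm. -/
abbrev BoundedOp (X : Type*) [NormedAddCommGroup X] [NormedSpace ℂ X] : Type _ := X →L[ℂ] X

section Operators

variable (X : Type*) [NormedAddCommGroup X] [NormedSpace ℂ X]

/-- `S(X)`: the operators on `X` whose range is separable. -/
def separableRangeOp : Submodule ℂ (BoundedOp X) where
  carrier := {T | TopologicalSpace.IsSeparable (Set.range T)}
  add_mem' := by
    intro S T hS hT
    refine ((hS.prod hT).image (f := fun p : X × X => p.1 + p.2) continuous_add).mono ?_
    rintro _ ⟨x, rfl⟩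
    exact ⟨(S x, T x), ⟨⟨x, rfl⟩, ⟨x, rfl⟩⟩, rfl⟩
  zero_mem' := by
    refine (Set.countable_singleton (0 : X)).isSeparable.mono ?_
    rintro _ ⟨x, rfl⟩
    rfl
  smul_mem' := by
    intro c T hT
    refine (hT.image (f := fun y : X => c • y) (continuous_const_smul c)).mono ?_
    rintro _ ⟨x, rfl⟩
    exact ⟨T x, ⟨x, rfl⟩, rfl⟩

variable {X} in
theorem mem_separableRangeOp {T : BoundedOp X} :
    T ∈ separableRangeOp X ↔ TopologicalSpace.IsSeparable (Set.range T) := Iff.rfl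

variable {X} in
/-- `S(X)` is a two-sided ideal: left multiples. -/
theorem mul_mem_separableRangeOp_left (A : BoundedOp X) {T : BoundedOp X}
    (hT : T ∈ separableRangeOp X) : A * T ∈ separableRangeOp X := by
  refine (TopologicalSpace.IsSeparable.image hT A.continuous).mono ?_
  rintro _ ⟨x, rfl⟩
  exact ⟨T x, ⟨x, rfl⟩, rfl⟩

variable {X} in
/-- `S(X)` is a two-sided ideal: right multiples. -/
theorem mul_mem_separableRangeOp_right (A : BoundedOp X) {T : BoundedOp X}
    (hT : T ∈ separableRangeOp X) : T * A ∈ separableRangeOp X := by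
  refine TopologicalSpace.IsSeparable.mono hT ?_
  rintro _ ⟨x, rfl⟩
  exact ⟨A x, rfl⟩

/-- `S(X)` is norm closed, so that the quotient seminorm on `B(X) / S(X)` is a norm. -/
theorem isClosed_separableRangeOp : IsClosed (separableRangeOp X : Set (BoundedOp X)) := by
  refine IsSeqClosed.isClosed ?_
  intro u T hu hT
  have hsep : TopologicalSpace.IsSeparable (⋃ n, Set.range (u n)) :=
    TopologicalSpace.isSeparable_iUnion.2 fun n => hu n
  refine hsep.closure.mono ?_
  rintro _ ⟨x, rfl⟩
  have hx : Filter.Tendsto (fun n => u n x) Filter.atTop (nhds (T x)) :=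
    ((ContinuousLinearMap.apply ℂ X x).continuous.tendsto T).comp hT
  exact mem_closure_of_tendsto hx
    (Filter.Eventually.of_forall fun n => Set.mem_iUnion.2 ⟨n, x, rfl⟩)

/-- `K(X)`: the compact operators on `X`. -/
abbrev compactOp : Submodule ℂ (BoundedOp X) := compactOperator (RingHom.id ℂ) X X

/-- `K(X)` is norm closed, so that the quotient seminorm on `B(X) / K(X)` is a norm. -/
theorem isClosed_compactOp [CompleteSpace X] : IsClosed (compactOp X : Set (BoundedOp X)) :=
  isClosed_setOfPred_isCompactOperator

/-- The quotient `B(X) / S(X)`, with the quotient norm. -/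
abbrev ModSeparableRange : Type _ := BoundedOp X ⧸ separableRangeOp X

/-- The Calkin algebra `C(X) = B(X) / K(X)`, with the quotient norm. -/
abbrev CalkinAlgebra : Type _ := BoundedOp X ⧸ compactOp X

/-- The topology `τ` on `B(X)` of uniform convergence on separable subspaces. It is generated by the
sets `{T | ‖T₁|Y - T|Y‖ < ε, …, ‖Tₙ|Y - T|Y‖ < ε}`, where `T₁, …, Tₙ ∈ B(X)`, `Y` is a separable
linear subspace of `X`, `ε > 0`, and the norms are those of `B(Y, X)`. -/
@[reducible] def separableSubspaceTopology : TopologicalSpace (BoundedOp X) :=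
  TopologicalSpace.generateFrom
    {U | ∃ (n : ℕ) (S : Fin n → BoundedOp X) (Y : Submodule ℂ X) (ε : ℝ),
      TopologicalSpace.IsSeparable (Y : Set X) ∧ 0 < ε ∧
      U = {T | ∀ i, ‖(S i).comp Y.subtypeL - T.comp Y.subtypeL‖ < ε}}

/-- The topology that `τ` induces on the Calkin algebra, namely the quotient topology. (The quotient
map is open for `τ`, so the open sets are exactly the images of the `τ`-open sets.) -/
@[reducible] def calkinSeparableSubspaceTopology : TopologicalSpace (CalkinAlgebra X) :=
  TopologicalSpace.coinduced (compactOp X).mkQ (separableSubspaceTopology X)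

end Operators

section ConvexTransitive

variable (X : Type*) [SeminormedAddCommGroup X] [NormedSpace ℂ X]

variable {X} in
/-- The orbit `G(x)` of `x` under the group of (complex-linear, surjective) isometric automorphisms
of `X`. -/
def isometryOrbit (x : X) : Set X := Set.range fun g : X ≃ₗᵢ[ℂ] X => g x

/-- `X` is `t`-convex-transitive, for a topology `t` on `X`: for every norm-one vector `x`, the
`t`-closed convex hull of the orbit of `x` is the closed unit ball of the norm. -/
def IsConvexTransitiveFor (t : TopologicalSpace X) : Prop :=
  ∀ x : X, ‖x‖ = 1 → @closure X t (convexHull ℝ (isometryOrbit x)) = Metric.closedBall (0 : X) 1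

/-- `X` is convex-transitive: for every norm-one vector `x`, the norm-closed convex hull of the orbit
of `x` is the closed unit ball. -/
def IsConvexTransitive : Prop :=
  ∀ x : X, ‖x‖ = 1 → closure (convexHull ℝ (isometryOrbit x)) = Metric.closedBall (0 : X) 1

end ConvexTransitive

/-! ### The Russo–Dye theorem. -/

section RussoDye

variable {A : Type*} [CStarAlgebra A]

/-! Let `J` be the ideal and `T` an operator whose class has norm one. Multiplying by unitaries on
both sides induces isometries of the quotient, so by Russo–Dye the closed convex hull of the orbit
contains the class of `A * T * B` for all contractions `A`, `B`. It remains to produce enough such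
products.

If `J` absorbs `T * spanProj s` for every `s` of fewer than `l` vectors, Zorn's lemma gives `l`
orthonormal vectors with orthogonal images of norm close to one
(`exists_orthonormal_orthogonal_image`). On their span a suitable lift of the class is nearly
isometric, so `A * T * B` can approximate, modulo `J`, any product of contractions through `ℓ²(ι)`
with `#ι ≤ l` (`exists_mul_mul_sub_le`).

For separable range, `l = ℵ₁` and the identity itself factors. For compact operators, `l = ℵ₀` and
projections onto separable subspaces factor. Since `S * P` agrees with `S` on the range of such a
projection `P`, this gives density for `τ`. The ball is `τ`-closed because a norm above one is
witnessed on a separable subspace. -/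

theorem IsSelfAdjoint.exists_unitary_add_eq_two_smul {a : A} (ha : IsSelfAdjoint a)
    (hn : ‖a‖ ≤ 1) : ∃ u ∈ unitary A, ∃ v ∈ unitary A, u + v = (2 : ℝ) • a := by
  let _ := CStarAlgebra.spectralOrder
  let _ := CStarAlgebra.spectralOrderedRing
  have h := ha.self_add_I_smul_cfcSqrt_sub_sq_mem_unitary a hn
  refine ⟨_, h, _, Unitary.star_mem h, ?_⟩
  simp only [star_add, star_smul, ha.star_eq, (CFC.sqrt_nonneg (1 - a ^ 2)).isSelfAdjoint.star_eq,
    RCLike.star_def, Complex.conj_I, neg_smul, two_smul]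
  abel

/-- Polar decomposition: an invertible `b` is a unitary times `CFC.abs b`, which reduces to the
self-adjoint case. -/
theorem IsUnit.exists_unitary_add_eq_two_smul {b : A} (hb : IsUnit b) (hn : ‖b‖ ≤ 1) :
    ∃ u ∈ unitary A, ∃ v ∈ unitary A, u + v = (2 : ℝ) • b := by
  let _ := CStarAlgebra.spectralOrder
  let _ := CStarAlgebra.spectralOrderedRing
  have hsa : IsSelfAdjoint (CFC.abs b) := (CFC.abs_nonneg b).isSelfAdjoint
  have hu : IsUnit (CFC.abs b) := by
    have h : IsUnit (CFC.abs b * CFC.abs b) := by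
      rw [CFC.abs_mul_abs]; exact hb.star.mul hb
    exact ((Commute.refl (CFC.abs b)).isUnit_mul_iff.1 h).1
  obtain ⟨h, hh⟩ := hu
  have hs : star (↑h⁻¹ : A) = ↑h⁻¹ := by
    have h1 : star h = h := Units.ext (by simpa [hh] using hsa.star_eq)
    have := congrArg (fun z : Aˣ => (↑z : A)) (congrArg (·⁻¹) h1)
    simpa using this
  have hw1 : star (b * ↑h⁻¹) * (b * (↑h⁻¹ : A)) = 1 := by
    rw [star_mul, hs, mul_assoc, ← mul_assoc (star b), ← CFC.abs_mul_abs, ← hh]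
    simp [mul_assoc]
  have hwu : IsUnit (b * (↑h⁻¹ : A)) := hb.mul (Units.isUnit _)
  have hw : b * (↑h⁻¹ : A) ∈ unitary A := by
    refine Unitary.mem_iff.2 ⟨hw1, ?_⟩
    exact left_inv_eq_right_inv hw1 (hwu.mul_val_inv) ▸ hwu.mul_val_inv
  obtain ⟨u, hu, v, hv, huv⟩ := hsa.exists_unitary_add_eq_two_smul (by simpa using hn)
  refine ⟨_, mul_mem hw hu, _, mul_mem hw hv, ?_⟩
  rw [← mul_add, huv, mul_smul_comm, mul_assoc, ← hh, Units.inv_mul, mul_one]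

theorem exists_unitary_add_eq {a u : A} (ha : ‖a‖ < 1) (hu : u ∈ unitary A) :
    ∃ v ∈ unitary A, ∃ w ∈ unitary A, v + w = a + u := by
  nontriviality A
  have h1 : ‖star u * a‖ < 1 := by
    rwa [CStarRing.norm_mem_unitary_mul _ (Unitary.star_mem hu)]
  have h2 : IsUnit (a + u) := by
    have : a + u = u * (1 - -(star u * a)) := by
      rw [sub_neg_eq_add, mul_add, ← mul_assoc, (Unitary.mem_iff.1 hu).2, mul_one, one_mul, add_comm]
    rw [this]
    refine IsUnit.mul ?_ (isUnit_one_sub_of_norm_lt_one (by rwa [norm_neg]))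
    exact ⟨⟨u, star u, (Unitary.mem_iff.1 hu).2, (Unitary.mem_iff.1 hu).1⟩, rfl⟩
  have h3 : IsUnit ((2⁻¹ : ℝ) • (a + u)) := h2.smul (Units.mk0 (2⁻¹ : ℝ) (by norm_num))
  obtain ⟨v, hv, w, hw, h⟩ := h3.exists_unitary_add_eq_two_smul (by
    rw [norm_smul]
    have := norm_add_le a u
    rw [CStarRing.norm_of_mem_unitary hu] at this
    norm_num
    linarith)
  exact ⟨v, hv, w, hw, by rw [h, smul_smul]; norm_num⟩

/-- For `‖a‖ < 1` the map `p ↦ (a + p) / 2` preserves the closed hull, since it sends a unitary to a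
mean of two unitaries. Its iterates from `1` converge to `a`. -/
theorem closedBall_subset_closure_convexHull_unitary :
    Metric.closedBall (0 : A) 1 ⊆ closure (convexHull ℝ (unitary A : Set A)) := by
  have hconv : Convex ℝ (closure (convexHull ℝ (unitary A : Set A))) :=
    (convex_convexHull ℝ _).closure
  rw [← closure_ball (0 : A) one_ne_zero]
  refine closure_minimal (fun a ha => ?_) isClosed_closure
  rw [mem_ball_zero_iff] at ha
  have step : closure (convexHull ℝ (unitary A : Set A)) ⊆
      {p | (2⁻¹ : ℝ) • a + (2⁻¹ : ℝ) • p ∈ closure (convexHull ℝ (unitary A : Set A))} := by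
    refine closure_minimal (convexHull_min (fun u hu => ?_) ?_) ?_
    · obtain ⟨v, hv, w, hw, h⟩ := exists_unitary_add_eq ha hu
      rw [Set.mem_ofPred_eq, ← smul_add, ← h, smul_add]
      exact hconv (subset_closure (subset_convexHull ℝ _ hv))
        (subset_closure (subset_convexHull ℝ _ hw)) (by norm_num) (by norm_num) (by norm_num)
    · intro p hp q hq s t hs ht hst
      have := hconv hp hq hs ht hst
      have e : s • ((2⁻¹ : ℝ) • a + (2⁻¹ : ℝ) • p) + t • ((2⁻¹ : ℝ) • a + (2⁻¹ : ℝ) • q) =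
          (2⁻¹ : ℝ) • a + (2⁻¹ : ℝ) • (s • p + t • q) := by
        obtain rfl : t = 1 - s := by linarith
        module
      rwa [e] at this
    · exact isClosed_closure.preimage (by fun_prop)
  have hp : ∀ n : ℕ, a + ((2⁻¹ : ℝ) ^ n) • (1 - a) ∈ closure (convexHull ℝ (unitary A : Set A)) := by
    intro n
    induction n with
    | zero =>
      simpa using subset_closure (subset_convexHull ℝ _ (one_mem (unitary A)))
    | succ n ih =>
      have e : (2⁻¹ : ℝ) • a + (2⁻¹ : ℝ) • (a + ((2⁻¹ : ℝ) ^ n) • (1 - a)) =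
          a + ((2⁻¹ : ℝ) ^ (n + 1)) • (1 - a) := by
        rw [pow_succ]
        module
      exact e ▸ step ih
  have h0 := tendsto_pow_atTop_nhds_zero_of_lt_one (r := (2⁻¹ : ℝ)) (by norm_num) (by norm_num)
  have h1 := (tendsto_const_nhds (x := a)).add (h0.smul_const (1 - a))
  rw [zero_smul, add_zero] at h1
  exact isClosed_closure.mem_of_tendsto h1 (Filter.Eventually.of_forall hp)

end RussoDye

/-! ### Norms and isometries on quotients. -/

section Quotient

variable {M : Type*} [NormedAddCommGroup M] [NormedSpace ℂ M] {J : Submodule ℂ M}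

theorem le_mul_norm_of_forall_mkQ_eq {q : M ⧸ J} {r c : ℝ} (hc : 0 ≤ c)
    (h : ∀ m : M, J.mkQ m = q → r ≤ c * ‖m‖) : r ≤ c * ‖q‖ := by
  refine le_of_forall_pos_le_add fun ε hε => ?_
  -- Dividing by `c + 1` rather than `c` covers `c = 0`.
  obtain ⟨m, hm, hm'⟩ := Submodule.Quotient.norm_mk_lt q (ε := ε / (c + 1)) (by positivity)
  calc r ≤ c * ‖m‖ := h m hm
    _ ≤ c * (‖q‖ + ε / (c + 1)) := by gcongr
    _ = c * ‖q‖ + c / (c + 1) * ε := by ring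
    _ ≤ c * ‖q‖ + 1 * ε := by
      gcongr
      rw [div_le_one (by positivity)]
      linarith
    _ = _ := by ring

theorem norm_mk_map_le (f : M →ₗ[ℂ] M) {c : ℝ} (hc : 0 ≤ c) (hf : ∀ m, ‖f m‖ ≤ c * ‖m‖)
    (hJ : ∀ m ∈ J, f m ∈ J) (m : M) : ‖J.mkQ (f m)‖ ≤ c * ‖J.mkQ m‖ := by
  refine le_mul_norm_of_forall_mkQ_eq hc fun m' hm' => ?_
  have : J.mkQ (f m) = J.mkQ (f m') := by
    rw [← sub_eq_zero, ← map_sub, ← map_sub, Submodule.mkQ_apply, Submodule.Quotient.mk_eq_zero]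
    refine hJ _ ?_
    rw [← Submodule.Quotient.mk_eq_zero, ← Submodule.mkQ_apply, map_sub, hm', sub_self]
  rw [this]
  exact (Submodule.Quotient.norm_mk_le J _).trans (hf m')

/-- An isometric automorphism preserving a subspace descends to the quotient. -/
theorem exists_quotient_linearIsometryEquiv (e : M ≃ₗ[ℂ] M) (he : ∀ m, ‖e m‖ = ‖m‖)
    (h : ∀ m ∈ J, e m ∈ J) (h' : ∀ m ∈ J, e.symm m ∈ J) :
    ∃ g : (M ⧸ J) ≃ₗᵢ[ℂ] (M ⧸ J), ∀ m, g (J.mkQ m) = J.mkQ (e m) := by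
  have hJ : J.map (e : M →ₗ[ℂ] M) = J := by
    ext m
    refine ⟨?_, fun hm => ⟨e.symm m, h' m hm, by simp⟩⟩
    rintro ⟨m, hm, rfl⟩
    exact h m hm
  refine ⟨⟨Submodule.Quotient.equiv J J e hJ, fun q => ?_⟩, fun m => rfl⟩
  obtain ⟨m, rfl⟩ := J.mkQ_surjective q
  change ‖J.mkQ (e m)‖ = ‖J.mkQ m‖
  refine le_antisymm ?_ ?_
  · simpa using norm_mk_map_le (e : M →ₗ[ℂ] M) zero_le_one (fun m => by simp [he]) h m
  · simpa using norm_mk_map_le (e.symm : M →ₗ[ℂ] M) zero_le_one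
      (fun m => by simp [← he (e.symm m)]) h' (e m)

end Quotient

/-! ### Orbits modulo a two-sided ideal. -/

section Ideal

variable {H : Type*} [NormedAddCommGroup H] [InnerProductSpace ℂ H] [CompleteSpace H]
  {J : Submodule ℂ (BoundedOp H)}

theorem mkQ_unitary_mul_mul_mem_isometryOrbit
    (hl : ∀ A : BoundedOp H, ∀ T ∈ J, A * T ∈ J) (hr : ∀ A : BoundedOp H, ∀ T ∈ J, T * A ∈ J)
    {U V : BoundedOp H} (hU : U ∈ unitary (BoundedOp H)) (hV : V ∈ unitary (BoundedOp H))
    (T : BoundedOp H) : J.mkQ (U * T * V) ∈ isometryOrbit (J.mkQ T) := by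
  let e : BoundedOp H ≃ₗ[ℂ] BoundedOp H :=
    { toFun := fun T => U * T * V
      invFun := fun T => star U * T * star V
      map_add' := fun S T => by rw [mul_add, add_mul]
      map_smul' := fun c T => by simp
      left_inv := fun T => by
        calc star U * (U * T * V) * star V = (star U * U) * T * (V * star V) := by
              simp only [mul_assoc]
          _ = T := by rw [(Unitary.mem_iff.1 hU).1, (Unitary.mem_iff.1 hV).2, one_mul, mul_one]
      right_inv := fun T => by
        calc U * (star U * T * star V) * V = (U * star U) * T * (star V * V) := by
              simp only [mul_assoc]
          _ = T := by rw [(Unitary.mem_iff.1 hU).2, (Unitary.mem_iff.1 hV).1, one_mul, mul_one] }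
  obtain ⟨g, hg⟩ := exists_quotient_linearIsometryEquiv (J := J) e
    (fun m => by
      change ‖U * m * V‖ = ‖m‖
      rw [CStarRing.norm_mul_mem_unitary _ hV, CStarRing.norm_mem_unitary_mul _ hU])
    (fun m hm => hr _ _ (hl _ _ hm)) (fun m hm => hr _ _ (hl _ _ hm))
  exact ⟨g, hg T⟩

/-- By the Russo-Dye theorem, the closed convex hull of the orbit absorbs contractions. -/
theorem mkQ_mul_mul_mem_closure_convexHull
    (hl : ∀ A : BoundedOp H, ∀ T ∈ J, A * T ∈ J) (hr : ∀ A : BoundedOp H, ∀ T ∈ J, T * A ∈ J)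
    (T : BoundedOp H) {A B : BoundedOp H} (hA : ‖A‖ ≤ 1) (hB : ‖B‖ ≤ 1) :
    J.mkQ (A * T * B) ∈ closure (convexHull ℝ (isometryOrbit (J.mkQ T))) := by
  have hmk : Continuous J.mkQ := continuous_quot_mk
  have hconv : Convex ℝ (closure (convexHull ℝ (isometryOrbit (J.mkQ T)))) :=
    (convex_convexHull ℝ _).closure
  -- Passes from unitaries to contractions in one factor; it is used for the left factor, then for
  -- the right.
  have key : ∀ L : BoundedOp H →ₗ[ℝ] BoundedOp H, Continuous L →
      (∀ U ∈ unitary (BoundedOp H),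
        J.mkQ (L U) ∈ closure (convexHull ℝ (isometryOrbit (J.mkQ T)))) →
      ∀ A : BoundedOp H, ‖A‖ ≤ 1 →
        J.mkQ (L A) ∈ closure (convexHull ℝ (isometryOrbit (J.mkQ T))) := by
    intro L hL hu A hA
    have hA' := closedBall_subset_closure_convexHull_unitary (mem_closedBall_zero_iff.2 hA)
    have hsub : closure (convexHull ℝ (unitary (BoundedOp H) : Set (BoundedOp H))) ⊆
        (((J.mkQ.restrictScalars ℝ).comp L) ⁻¹'
          closure (convexHull ℝ (isometryOrbit (J.mkQ T)))) :=
      closure_minimal (convexHull_min hu (hconv.linear_preimage _))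
        (isClosed_closure.preimage (hmk.comp hL))
    exact hsub hA'
  refine key (((LinearMap.mulRight ℝ B).comp (LinearMap.mulRight ℝ T)))
    ((continuous_mul_const T).mul_const B) (fun U hU => ?_) A hA
  refine key (LinearMap.mulLeft ℝ (U * T)) (continuous_const_mul _) (fun V hV => ?_) B hB
  exact subset_closure (subset_convexHull ℝ _
    (mkQ_unitary_mul_mul_mem_isometryOrbit hl hr hU hV T))

theorem mkQ_mul_mem_closure_convexHull
    (hl : ∀ A : BoundedOp H, ∀ T ∈ J, A * T ∈ J) (hr : ∀ A : BoundedOp H, ∀ T ∈ J, T * A ∈ J)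
    {T P S : BoundedOp H}
    (hP : ∀ ε > 0, ∃ A B : BoundedOp H, ‖A‖ ≤ 1 ∧ ‖B‖ ≤ 1 ∧ ‖J.mkQ (A * T * B - P)‖ ≤ ε)
    (hS : ‖J.mkQ S‖ ≤ 1) :
    J.mkQ (S * P) ∈ closure (convexHull ℝ (isometryOrbit (J.mkQ T))) := by
  set C := closure (convexHull ℝ (isometryOrbit (J.mkQ T)))
  have h1 : ∀ R : BoundedOp H, ‖R‖ ≤ 1 → J.mkQ (R * P) ∈ C := by
    intro R hR
    refine isClosed_closure.closure_subset (Metric.mem_closure_iff.2 fun ε hε => ?_)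
    obtain ⟨A, B, hA, hB, h⟩ := hP (ε / 2) (by positivity)
    refine ⟨J.mkQ ((R * A) * T * B), mkQ_mul_mul_mem_closure_convexHull hl hr T
      ((norm_mul_le _ _).trans (mul_le_one₀ hR (norm_nonneg _) hA)) hB, ?_⟩
    rw [dist_comm, dist_eq_norm, ← map_sub]
    have e : R * A * T * B - R * P = LinearMap.mulLeft ℂ R (A * T * B - P) := by
      simp [mul_sub, mul_assoc]
    rw [e]
    have := norm_mk_map_le (J := J) (LinearMap.mulLeft ℂ R) zero_le_one
      (fun m => (norm_mul_le _ _).trans (by gcongr)) (fun m hm => hl _ _ hm) (A * T * B - P)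
    linarith
  -- The quotient norm need not be attained by the lift at hand: rescale one of norm below `1 + δ`,
  -- then let `δ → 0`.
  have h2 : ∀ δ : ℝ, 0 < δ → ((1 + δ)⁻¹ : ℝ) • J.mkQ (S * P) ∈ C := by
    intro δ hδ
    obtain ⟨m, hm, hm'⟩ := Submodule.Quotient.norm_mk_lt (J.mkQ S) hδ
    have hm1 : ‖((1 + δ)⁻¹ : ℝ) • m‖ ≤ 1 := by
      rw [norm_smul, Real.norm_of_nonneg (by positivity), inv_mul_le_one₀ (by positivity)]
      linarith
    have e : J.mkQ (S * P) = J.mkQ (m * P) := by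
      rw [← sub_eq_zero, ← map_sub, ← sub_mul, Submodule.mkQ_apply,
        Submodule.Quotient.mk_eq_zero]
      refine hr _ _ ?_
      rw [← Submodule.Quotient.mk_eq_zero, Submodule.Quotient.mk_sub, hm, sub_eq_zero]
      rfl
    have := h1 _ hm1
    rw [smul_mul_assoc] at this
    rw [e]
    exact this
  have h3 : Filter.Tendsto (fun δ : ℝ => ((1 + δ)⁻¹ : ℝ) • J.mkQ (S * P))
      (nhdsWithin 0 (Set.Ioi 0)) (nhds (((1 + 0)⁻¹ : ℝ) • J.mkQ (S * P))) := by
    refine Filter.Tendsto.smul_const (tendsto_nhdsWithin_of_tendsto_nhds ?_) _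
    exact ContinuousAt.tendsto (f := fun δ : ℝ => (1 + δ)⁻¹)
      (ContinuousAt.inv₀ (by fun_prop) (by norm_num))
  rw [add_zero, inv_one, one_smul] at h3
  exact isClosed_closure.mem_of_tendsto h3 (Filter.eventually_of_mem self_mem_nhdsWithin h2)

end Ideal

theorem convexHull_isometryOrbit_subset_closedBall {X : Type*} [SeminormedAddCommGroup X] [NormedSpace ℂ X]
    {x : X} (hx : ‖x‖ = 1) : convexHull ℝ (isometryOrbit x) ⊆ Metric.closedBall 0 1 := by
  refine convexHull_min ?_ (convex_closedBall _ _)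
  rintro _ ⟨g, rfl⟩
  simp [hx]

/-! ### Large orthonormal families and compressions. -/

section Family

variable {H : Type u} [NormedAddCommGroup H] [InnerProductSpace ℂ H] [CompleteSpace H]
  {J : Submodule ℂ (BoundedOp H)}

local notation "⟪" x ", " y "⟫" => inner ℂ x y

/-- The orthogonal projection onto the closed linear span of a set. -/
noncomputable def spanProj (s : Set H) : BoundedOp H :=
  (Submodule.span ℂ s).topologicalClosure.starProjection

theorem spanProj_apply_of_mem {s : Set H} {x : H} (hx : x ∈ s) : spanProj s x = x :=
  Submodule.starProjection_eq_self_iff.2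
    (Submodule.le_topologicalClosure _ (Submodule.subset_span hx))

/-- Composing `T` with the complementary projection does not change its class, so its norm still
exceeds `c` there. -/
theorem exists_unit_orthogonal {T : BoundedOp H} {c : ℝ} (hc : 0 ≤ c) (hT : c < ‖J.mkQ T‖)
    {s : Set H} (hs : T * spanProj s ∈ J) :
    ∃ x : H, ‖x‖ = 1 ∧ c < ‖T x‖ ∧ ∀ y ∈ s, ⟪y, x⟫ = 0 := by
  have h1 : c < ‖T * (1 - spanProj s)‖ := by
    refine hT.trans_le ?_
    have : J.mkQ T = J.mkQ (T * (1 - spanProj s)) := by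
      rw [← sub_eq_zero, ← map_sub, Submodule.mkQ_apply, Submodule.Quotient.mk_eq_zero]
      simpa [mul_sub] using hs
    rw [this]
    exact Submodule.Quotient.norm_mk_le J _
  obtain ⟨v, hv⟩ : ∃ v, c * ‖v‖ < ‖(T * (1 - spanProj s)) v‖ := by
    by_contra! h
    exact absurd (ContinuousLinearMap.opNorm_le_bound _ hc h) (not_le.2 h1)
  set K := (Submodule.span ℂ s).topologicalClosure
  set w := v - spanProj s v
  have hw : w ∈ Kᗮ := Submodule.sub_starProjection_mem_orthogonal v
  have hTw : (T * (1 - spanProj s)) v = T w := rfl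
  have hwv : ‖w‖ ≤ ‖v‖ := by
    have e : w = Kᗮ.starProjection v := by
      rw [Submodule.starProjection_orthogonal']
      rfl
    rw [e]
    exact Submodule.norm_starProjection_apply_le _ _
  rw [hTw] at hv
  have hw0 : w ≠ 0 := by
    intro h
    rw [h, map_zero, norm_zero] at hv
    exact absurd hv (not_lt.2 (by positivity))
  have hwn : 0 < ‖w‖ := norm_pos_iff.2 hw0
  refine ⟨((‖w‖⁻¹ : ℝ) : ℂ) • w, ?_, ?_, ?_⟩
  · rw [norm_smul, Complex.norm_real, norm_inv, norm_norm, inv_mul_cancel₀ hwn.ne']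
  · rw [map_smul, norm_smul, Complex.norm_real, norm_inv, norm_norm, lt_inv_mul_iff₀ hwn, mul_comm]
    exact (mul_le_mul_of_nonneg_left hwv hc).trans_lt hv
  · intro y hy
    rw [inner_smul_right,
      hw y (Submodule.le_topologicalClosure _ (Submodule.subset_span hy)), mul_zero]

/-- An operator whose class has norm above `c` admits a large orthonormal family with orthogonal
images of norm above `c`. -/
theorem exists_orthonormal_orthogonal_image {T : BoundedOp H} {c : ℝ} (hc : 0 ≤ c)
    (hT : c < ‖J.mkQ T‖) {l : Cardinal.{u}} (hl : ℵ₀ ≤ l)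
    (hJ : ∀ s : Set H, #s < l → T * spanProj s ∈ J) :
    ∃ s : Set H, l ≤ #s ∧ (∀ x ∈ s, ‖x‖ = 1 ∧ c < ‖T x‖) ∧
      s.Pairwise fun x y => ⟪x, y⟫ = 0 ∧ ⟪T x, T y⟫ = 0 := by
  obtain ⟨s, hs⟩ := zorn_subset {s : Set H | (∀ x ∈ s, ‖x‖ = 1 ∧ c < ‖T x‖) ∧
      s.Pairwise fun x y => ⟪x, y⟫ = 0 ∧ ⟪T x, T y⟫ = 0} (by
    intro C hC hchain
    refine ⟨⋃₀ C, ⟨?_, ?_⟩, fun s hs => Set.subset_sUnion_of_mem hs⟩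
    · rintro x ⟨s, hs, hx⟩
      exact (hC hs).1 x hx
    · exact (Set.pairwise_sUnion hchain.directedOn).2 fun s hs => (hC hs).2)
  refine ⟨s, ?_, hs.prop⟩
  by_contra! hcard
  -- Orthogonality to `T* T y` as well as to `y` makes `T x` orthogonal to `T y`. The new `x` then
  -- contradicts maximality.
  obtain ⟨x, hx1, hxc, hx⟩ := exists_unit_orthogonal hc hT
    (hJ (s ∪ (fun y => ContinuousLinearMap.adjoint T (T y)) '' s)
      ((Cardinal.mk_union_le _ _).trans_lt
        (Cardinal.add_lt_of_lt hl hcard (Cardinal.mk_image_le.trans_lt hcard))))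
  have hx' : ∀ y ∈ s, ⟪y, x⟫ = 0 ∧ ⟪T y, T x⟫ = 0 := by
    intro y hy
    refine ⟨hx y (Or.inl hy), ?_⟩
    rw [← ContinuousLinearMap.adjoint_inner_left]
    exact hx _ (Or.inr ⟨y, hy, rfl⟩)
  have hins := hs.le_of_ge (y := insert x s) ⟨?_, ?_⟩ (Set.subset_insert _ _)
  · have hxs : x ∈ s := hins (Set.mem_insert _ _)
    have := (hx' x hxs).1
    rw [inner_self_eq_zero] at this
    simp [this] at hx1
  · rintro y (rfl | hy)
    · exact ⟨hx1, hxc⟩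
    · exact hs.prop.1 y hy
  · refine hs.prop.2.insert fun y hy _ => ⟨⟨?_, ?_⟩, hx' y hy⟩
    · exact inner_eq_zero_symm.1 (hx' y hy).1
    · exact inner_eq_zero_symm.1 (hx' y hy).2

/-- The isometry `ℓ²(ι) → H` defined by an orthonormal family. -/
noncomputable def Orthonormal.lpIsometry {ι : Type*} {x : ι → H} (hx : Orthonormal ℂ x) :
    EllTwo ι →ₗᵢ[ℂ] H := hx.orthogonalFamily.linearIsometry

theorem Orthonormal.hasSum_lpIsometry {ι : Type*} {x : ι → H} (hx : Orthonormal ℂ x)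
    (a : EllTwo ι) : HasSum (fun i => a i • x i) (hx.lpIsometry a) :=
  hx.orthogonalFamily.hasSum_linearIsometry a

/-- The difference is diagonal with entries `t i - 1`; Pythagoras bounds the finite sums. -/
theorem Orthonormal.norm_map_lpIsometry_sub_le {ι : Type*} {x y : ι → H} (hx : Orthonormal ℂ x)
    (hy : Orthonormal ℂ y) {T : BoundedOp H} {t : ι → ℂ} (hT : ∀ i, T (x i) = t i • y i)
    {δ : ℝ} (hδ : 0 ≤ δ) (ht : ∀ i, ‖t i - 1‖ ≤ δ) (a : EllTwo ι) :
    ‖T (hx.lpIsometry a) - hy.lpIsometry a‖ ≤ δ * ‖a‖ := by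
  have h1 : HasSum (fun i => T (a i • x i) - a i • y i)
      (T (hx.lpIsometry a) - hy.lpIsometry a) :=
    (T.hasSum (hx.hasSum_lpIsometry a)).sub (hy.hasSum_lpIsometry a)
  rw [← hx.lpIsometry.norm_map a]
  refine le_of_tendsto_of_tendsto' h1.norm ((hx.hasSum_lpIsometry a).norm.const_mul δ)
    fun s => ?_
  have e1 : ∑ i ∈ s, (T (a i • x i) - a i • y i) = ∑ i ∈ s, (a i * (t i - 1)) • y i := by
    refine Finset.sum_congr rfl fun i _ => ?_
    rw [map_smul, hT]
    module
  have e2 := hy.orthogonalFamily.norm_sum (fun i => a i * (t i - 1)) s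
  have e3 := hx.orthogonalFamily.norm_sum (fun i => a i) s
  simp only [LinearIsometry.toSpanSingleton_apply] at e2 e3
  rw [e1]
  rw [← sq_le_sq₀ (norm_nonneg _) (by positivity), mul_pow, e2, e3, Finset.mul_sum]
  refine Finset.sum_le_sum fun i _ => ?_
  rw [norm_mul, mul_pow, mul_comm]
  gcongr
  exact ht i

/-- If the class of `T` has norm one, then compressions of `T` approximate every operator which
factors through `ℓ²(ι)`, where `ι` is not too large. -/
theorem exists_mul_mul_sub_le (hr : ∀ A : BoundedOp H, ∀ T ∈ J, T * A ∈ J)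
    (hl : ∀ A : BoundedOp H, ∀ T ∈ J, A * T ∈ J)
    {l : Cardinal.{u}} (hl0 : ℵ₀ ≤ l) (hJ : ∀ T : BoundedOp H, ∀ s : Set H, #s < l → T * spanProj s ∈ J)
    {T : BoundedOp H} (hT : ‖J.mkQ T‖ = 1) {ι : Type u} (hι : #ι ≤ l)
    {F : EllTwo ι →L[ℂ] H} {Q : H →L[ℂ] EllTwo ι} (hF : ‖F‖ ≤ 1) (hQ : ‖Q‖ ≤ 1)
    {ε : ℝ} (hε : 0 < ε) :
    ∃ A B : BoundedOp H, ‖A‖ ≤ 1 ∧ ‖B‖ ≤ 1 ∧ ‖J.mkQ (A * T * B - F ∘L Q)‖ ≤ ε := by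
  set δ : ℝ := min ε (1 / 2)
  have hδ : 0 < δ := by positivity
  have hδ1 : δ ≤ 1 / 2 := min_le_right _ _
  -- A lift of norm below `1 + δ` confines every `‖R (f i)‖` to the interval from `1 - δ` to `1 +
  -- δ`.
  obtain ⟨R, hR, hRn⟩ := Submodule.Quotient.norm_mk_lt (J.mkQ T) hδ
  rw [hT] at hRn
  obtain ⟨s, hs, hs1, hs2⟩ := exists_orthonormal_orthogonal_image (T := R) (c := 1 - δ)
    (by linarith) (by
      have : ‖J.mkQ R‖ = 1 := by rw [← hT, ← hR]; rfl
      rw [this]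
      linarith) hl0 (hJ R)
  obtain ⟨f⟩ : Nonempty (ι ↪ s) := Cardinal.le_def _ _ |>.1 (hι.trans hs)
  have hRpos : ∀ i, 0 < ‖R (f i)‖ := fun i => by
    have := (hs1 (f i) (f i).2).2
    linarith
  have hR0 : ∀ i, ((‖R (f i)‖ : ℝ) : ℂ) ≠ 0 := fun i =>
    Complex.ofReal_ne_zero.2 (hRpos i).ne'
  have hne : ∀ {i j}, i ≠ j → (f i : H) ≠ f j := fun h h' =>
    h (f.injective (Subtype.ext h'))
  have hx : Orthonormal ℂ (fun i => (f i : H)) :=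
    ⟨fun i => (hs1 _ (f i).2).1, fun i j hij => (hs2 (f i).2 (f j).2 (hne hij)).1⟩
  have hy : Orthonormal ℂ (fun i => ((‖R (f i)‖ : ℝ) : ℂ)⁻¹ • R (f i)) := by
    refine ⟨fun i => ?_, fun i j hij => ?_⟩
    · rw [norm_smul, norm_inv, Complex.norm_real, norm_norm, inv_mul_cancel₀ (hRpos i).ne']
    · change ⟪_ • _, _ • _⟫ = 0
      rw [inner_smul_left, inner_smul_right, (hs2 (f i).2 (f j).2 (hne hij)).2, mul_zero, mul_zero]
  set X := hx.lpIsometry.toContinuousLinearMap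
  set Y := hy.lpIsometry.toContinuousLinearMap
  have hX : ‖X‖ ≤ 1 := hx.lpIsometry.norm_toContinuousLinearMap_le
  have hY : ‖ContinuousLinearMap.adjoint Y‖ ≤ 1 := by
    rw [LinearIsometryEquiv.norm_map]
    exact hy.lpIsometry.norm_toContinuousLinearMap_le
  have hYY : ContinuousLinearMap.adjoint Y ∘L Y = ContinuousLinearMap.id ℂ _ :=
    (ContinuousLinearMap.norm_map_iff_adjoint_comp_self Y).1 hy.lpIsometry.norm_map
  have hXY : ‖R ∘L X - Y‖ ≤ δ := by
    refine ContinuousLinearMap.opNorm_le_bound _ hδ.le fun a => ?_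
    refine hx.norm_map_lpIsometry_sub_le hy (T := R) (t := fun i => ((‖R (f i)‖ : ℝ) : ℂ))
      (fun i => ?_) hδ.le (fun i => ?_) a
    · rw [smul_inv_smul₀ (hR0 i)]
    · rw [← Complex.ofReal_one, ← Complex.ofReal_sub, Complex.norm_real, Real.norm_eq_abs, abs_le]
      have h1 := (hs1 (f i) (f i).2).2
      have h2 := R.le_opNorm (f i)
      rw [(hs1 (f i) (f i).2).1, mul_one] at h2
      constructor <;> linarith
  refine ⟨F ∘L ContinuousLinearMap.adjoint Y, X ∘L Q,
    (ContinuousLinearMap.opNorm_comp_le _ _).trans (mul_le_one₀ hF (norm_nonneg _) hY),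
    (ContinuousLinearMap.opNorm_comp_le _ _).trans (mul_le_one₀ hX (norm_nonneg _) hQ), ?_⟩
  set A : BoundedOp H := F ∘L ContinuousLinearMap.adjoint Y
  set B : BoundedOp H := X ∘L Q
  have e : J.mkQ (A * T * B - F ∘L Q) = J.mkQ (A * R * B - F ∘L Q) := by
    rw [← sub_eq_zero, ← map_sub, sub_sub_sub_cancel_right, ← sub_mul, ← mul_sub,
      Submodule.mkQ_apply, Submodule.Quotient.mk_eq_zero]
    refine hr _ _ (hl _ _ ?_)
    rw [← Submodule.Quotient.mk_eq_zero, Submodule.Quotient.mk_sub, hR, sub_eq_zero]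
    rfl
  -- As `Y* Y = 1`, inserting it in `F ∘L Q` exposes the small factor `R ∘L X - Y`.
  have e' : A * R * B - F ∘L Q =
      F ∘L ContinuousLinearMap.adjoint Y ∘L (R ∘L X - Y) ∘L Q := by
    have : F ∘L Q = F ∘L (ContinuousLinearMap.adjoint Y ∘L Y) ∘L Q := by
      rw [hYY, ContinuousLinearMap.id_comp]
    rw [this]
    ext v
    simp [A, B]
  rw [e, e']
  refine (Submodule.Quotient.norm_mk_le J _).trans ?_
  calc _ ≤ ‖F‖ * (‖ContinuousLinearMap.adjoint Y‖ * (‖R ∘L X - Y‖ * ‖Q‖)) := by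
        refine (ContinuousLinearMap.opNorm_comp_le _ _).trans ?_
        gcongr
        refine (ContinuousLinearMap.opNorm_comp_le _ _).trans ?_
        gcongr
        exact ContinuousLinearMap.opNorm_comp_le _ _
    _ ≤ 1 * (1 * (δ * 1)) := by gcongr
    _ ≤ ε := by simpa only [one_mul, mul_one] using min_le_left _ _

end Family

/-! ### The compact operators as an ideal. -/

section Compact

variable {X : Type*} [NormedAddCommGroup X] [NormedSpace ℂ X]

theorem mul_mem_compactOp_left (A : BoundedOp X) {T : BoundedOp X} (hT : T ∈ compactOp X) :
    A * T ∈ compactOp X := IsCompactOperator.clm_comp hT A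

theorem mul_mem_compactOp_right (A : BoundedOp X) {T : BoundedOp X} (hT : T ∈ compactOp X) :
    T * A ∈ compactOp X := IsCompactOperator.comp_clm hT A

end Compact

/-! ### Small spans, compactness and separability in Hilbert space. -/

section Hilbert

variable {H : Type u} [NormedAddCommGroup H] [InnerProductSpace ℂ H] [CompleteSpace H]

theorem mul_spanProj_mem_separableRangeOp (T : BoundedOp H) {s : Set H} (hs : s.Countable) :
    T * spanProj s ∈ separableRangeOp H := by
  refine mul_mem_separableRangeOp_left T ?_
  refine (hs.isSeparable.span (R := ℂ)).closure.mono ?_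
  rintro _ ⟨x, rfl⟩
  exact Submodule.starProjection_apply_mem (Submodule.span ℂ s).topologicalClosure x

theorem mul_spanProj_mem_compactOp (T : BoundedOp H) {s : Set H} (hs : s.Finite) :
    T * spanProj s ∈ compactOp H := by
  have := FiniteDimensional.span_of_finite ℂ hs
  have hcl : (Submodule.span ℂ s).topologicalClosure = Submodule.span ℂ s :=
    (Submodule.closed_of_finiteDimensional _).submodule_topologicalClosure_eq
  have hfin : FiniteDimensional ℂ (Submodule.span ℂ s).topologicalClosure := by rwa [hcl]
  have := FiniteDimensional.proper ℂ (Submodule.span ℂ s).topologicalClosure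
  exact (isCompactOperator_of_locallyCompactSpace_dom
    (Submodule.span ℂ s).topologicalClosure.orthogonalProjectionOnto).clm_comp
      (T ∘L (Submodule.span ℂ s).topologicalClosure.subtypeL)

/-- Otherwise a subsequence of images converges to some `y ≠ 0`, while Bessel's inequality for `K*
y` forces the inner products with `y` to tend to zero. -/
theorem exists_norm_lt_of_mem_compactOp {K : BoundedOp H} (hK : K ∈ compactOp H) {s : Set H}
    (hs : s.Infinite) (hs' : Orthonormal ℂ ((↑) : s → H)) {r : ℝ} (hr : 0 < r) :
    ∃ x ∈ s, ‖K x‖ < r := by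
  by_contra! h
  let g : ℕ → H := fun n => (hs.natEmbedding s n : H)
  have hg : Orthonormal ℂ g := hs'.comp _ (hs.natEmbedding s).injective
  obtain ⟨C, hC, hKC⟩ := IsCompactOperator.image_closedBall_subset_compact
    (f := (K : H →ₗ[ℂ] H)) hK 1
  obtain ⟨y, -, φ, hφ, hy⟩ := hC.tendsto_subseq (x := fun n => K (g n)) fun n =>
    hKC ⟨g n, by simp [hg.1 n], rfl⟩
  have hyr : r ≤ ‖y‖ := ge_of_tendsto' hy.norm fun n => h _ (hs.natEmbedding s (φ n)).2
  have h1 : Filter.Tendsto (fun n => ‖inner ℂ (K (g (φ n))) y‖ ^ 2) Filter.atTop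
      (nhds (‖inner ℂ y y‖ ^ 2)) := ((hy.inner tendsto_const_nhds).norm).pow 2
  have h2 := ((hg.comp φ hφ.injective).inner_products_summable
    (x := ContinuousLinearMap.adjoint K y)).tendsto_atTop_zero
  simp only [Function.comp_apply, ContinuousLinearMap.adjoint_inner_right] at h2
  have h3 := tendsto_nhds_unique h1 h2
  have h4 : y = 0 := by simpa using h3
  rw [h4, norm_zero] at hyr
  linarith

theorem Orthonormal.countable_of_separableSpace {E ι : Type*} [NormedAddCommGroup E]
    [InnerProductSpace ℂ E] [TopologicalSpace.SeparableSpace E] {x : ι → E}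
    (hx : Orthonormal ℂ x) : Countable ι := by
  have hd : ∀ i j, i ≠ j → 1 ≤ dist (x i) (x j) := by
    intro i j hij
    have h := norm_sub_sq (𝕜 := ℂ) (x i) (x j)
    rw [hx.2 hij, hx.1, hx.1] at h
    rw [dist_eq_norm]
    norm_num at h
    nlinarith [norm_nonneg (x i - x j)]
  rw [← Set.countable_univ_iff]
  refine Set.PairwiseDisjoint.countable_of_isOpen (s := fun i => Metric.ball (x i) (1 / 2))
    (fun i _ j _ hij => Metric.ball_disjoint_ball ?_) (fun i _ => Metric.isOpen_ball)
    (fun i _ => Metric.nonempty_ball.2 (by norm_num))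
  norm_num
  exact hd i j hij

end Hilbert

/-! ### Neighbourhoods for `τ`. -/

section Topology

open Topology

variable {X : Type*} [NormedAddCommGroup X] [NormedSpace ℂ X]

theorem exists_isSeparable_of_isOpen {W : Set (BoundedOp X)}
    (hW : IsOpen[separableSubspaceTopology X] W) {S : BoundedOp X} (hS : S ∈ W) :
    ∃ (s : Set X) (ε : ℝ), TopologicalSpace.IsSeparable s ∧ 0 < ε ∧
      ∀ T : BoundedOp X, (∀ y ∈ s, ‖S y - T y‖ ≤ ε * ‖y‖) → T ∈ W := by
  induction hW with
  | basic U hU =>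
    obtain ⟨n, R, Y, ε, hY, hε, rfl⟩ := hU
    -- The basic set need not be centred at `S`; `δ` fits in the slack of all finitely many strict
    -- inequalities.
    have h1 : ∀ᶠ δ in nhdsWithin (0 : ℝ) (Set.Ioi 0), ∀ i,
        ‖(R i).comp Y.subtypeL - S.comp Y.subtypeL‖ + δ < ε := by
      refine Filter.eventually_all.2 fun i => ?_
      refine (tendsto_nhdsWithin_of_tendsto_nhds ?_ : Filter.Tendsto
        (fun δ : ℝ => ‖(R i).comp Y.subtypeL - S.comp Y.subtypeL‖ + δ) _
          (nhds (‖(R i).comp Y.subtypeL - S.comp Y.subtypeL‖ + 0))).eventually_lt_const ?_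
      · exact (continuous_const.add continuous_id).tendsto 0
      · simpa using hS i
    obtain ⟨δ, hδ, hδ0⟩ := (h1.and self_mem_nhdsWithin).exists
    refine ⟨Y, δ, hY, hδ0, fun T hT i => ?_⟩
    have h2 : ‖S.comp Y.subtypeL - T.comp Y.subtypeL‖ ≤ δ :=
      ContinuousLinearMap.opNorm_le_bound _ (le_of_lt hδ0) fun y => hT y y.2
    calc _ ≤ ‖(R i).comp Y.subtypeL - S.comp Y.subtypeL‖ + ‖S.comp Y.subtypeL - T.comp Y.subtypeL‖ :=
          norm_sub_le_norm_sub_add_norm_sub ((R i).comp Y.subtypeL) (S.comp Y.subtypeL)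
            (T.comp Y.subtypeL)
      _ ≤ _ := by gcongr
      _ < ε := hδ i
  | univ => exact ⟨∅, 1, (Set.countable_empty).isSeparable, one_pos, fun T _ => trivial⟩
  | inter U V _ _ hU hV =>
    obtain ⟨s, ε, hs, hε, h⟩ := hU hS.1
    obtain ⟨s', ε', hs', hε', h'⟩ := hV hS.2
    refine ⟨s ∪ s', min ε ε', hs.union hs', lt_min hε hε', fun T hT => ⟨h T fun y hy => ?_,
      h' T fun y hy => ?_⟩⟩
    · exact (hT y (Or.inl hy)).trans (by gcongr; exact min_le_left _ _)
    · exact (hT y (Or.inr hy)).trans (by gcongr; exact min_le_right _ _)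
  | sUnion C _ ih =>
    obtain ⟨U, hU, hSU⟩ := hS
    obtain ⟨s, ε, hs, hε, h⟩ := ih U hU hSU
    exact ⟨s, ε, hs, hε, fun T hT => ⟨U, hU, h T hT⟩⟩

end Topology

/-! ### Closedness of the ball and convex-transitivity. -/

section Main

open Topology

variable {H : Type u} [NormedAddCommGroup H] [InnerProductSpace ℂ H] [CompleteSpace H]

/-- `T` is large on a whole orthonormal sequence, and a compact perturbation cannot cancel this
along the sequence. So an operator close to `T` on its separable span also has class of norm above
one. -/
theorem isOpen_one_lt_norm_mkQ_compactOp :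
    IsOpen[separableSubspaceTopology H] {T : BoundedOp H | 1 < ‖(compactOp H).mkQ T‖} := by
  refine (@isOpen_iff_forall_mem_open _ (separableSubspaceTopology H) _).2 fun T hT => ?_
  obtain ⟨c, hc, hcT⟩ := exists_between (show 1 < ‖(compactOp H).mkQ T‖ from hT)
  obtain ⟨s, hs, hs1, hs2⟩ := exists_orthonormal_orthogonal_image (c := c) (by linarith) hcT
    (le_refl ℵ₀) fun s hs => mul_spanProj_mem_compactOp T (Cardinal.lt_aleph0_iff_set_finite.1 hs)
  have hon : Orthonormal ℂ ((↑) : s → H) :=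
    ⟨fun x => (hs1 x x.2).1, fun x y hxy =>
      (hs2 x.2 y.2 (fun h => hxy (Subtype.ext h))).1⟩
  have hinf : s.Infinite := Set.infinite_coe_iff.1 (Cardinal.infinite_iff.2 hs)
  let f := hinf.natEmbedding s
  set s' : Set H := Set.range fun n => (f n : H)
  have hs's : s' ⊆ s := by
    rintro _ ⟨n, rfl⟩
    exact (f n).2
  have hinf' : s'.Infinite :=
    Set.infinite_range_of_injective (Subtype.val_injective.comp f.injective)
  have hon' : Orthonormal ℂ ((↑) : s' → H) :=
    hon.comp (Set.inclusion hs's) (Set.inclusion_injective hs's)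
  set Y := Submodule.span ℂ s'
  refine ⟨{R | ∀ _ : Fin 1, ‖T.comp Y.subtypeL - R.comp Y.subtypeL‖ < c - 1}, ?_,
    TopologicalSpace.isOpen_generateFrom_of_mem
    ⟨1, fun _ => T, Y, c - 1, (Set.countable_range _).isSeparable.span, by linarith, rfl⟩, ?_⟩
  · intro R hR
    have hR := hR 0
    by_contra hR1
    have hR1 : ‖(compactOp H).mkQ R‖ ≤ 1 := not_lt.1 hR1
    obtain ⟨d, hd, hd1⟩ := exists_between hR
    -- The gap `c - 1 - d` is split between the excess norm of the lift and the compact error at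
    -- `x`, so the total is at most `d + 1 + (c - 1 - d) = c`, against `c < ‖T x‖`.
    obtain ⟨m, hm, hm'⟩ := Submodule.Quotient.norm_mk_lt ((compactOp H).mkQ R)
      (ε := (c - 1 - d) / 2) (by linarith)
    have hmR : m - R ∈ compactOp H := (Submodule.Quotient.eq _).1 hm
    obtain ⟨x, hx, hxr⟩ := exists_norm_lt_of_mem_compactOp hmR hinf' hon'
      (r := (c - 1 - d) / 2) (by linarith)
    obtain ⟨hx1, hxc⟩ := hs1 x (hs's hx)
    have h1 := (T.comp Y.subtypeL - R.comp Y.subtypeL).le_opNorm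
      ⟨x, Submodule.subset_span hx⟩
    have h1' : ‖T x - R x‖ ≤ ‖T.comp Y.subtypeL - R.comp Y.subtypeL‖ * ‖x‖ := h1
    have h2 := m.le_opNorm x
    rw [hx1, mul_one] at h1' h2
    have h3 : ‖T x‖ ≤ ‖T x - R x‖ + ‖(m - R) x‖ + ‖m x‖ := by
      have e : T x = (T x - R x) - (m - R) x + m x := by simp
      calc ‖T x‖ = ‖(T x - R x) - (m - R) x + m x‖ := by rw [← e]
        _ ≤ _ := (norm_add_le _ _).trans (by gcongr; exact norm_sub_le _ _)
    linarith
  · intro _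
    rw [sub_self]
    exact (norm_zero (E := Y →L[ℂ] H)).trans_lt (by linarith)

theorem isClosed_closedBall_calkinAlgebra :
    IsClosed[calkinSeparableSubspaceTopology H]
      (Metric.closedBall (0 : CalkinAlgebra H) 1) := by
  refine (@isOpen_compl_iff _ _ (calkinSeparableSubspaceTopology H)).1 ?_
  refine isOpen_coinduced.2 ?_
  convert isOpen_one_lt_norm_mkQ_compactOp (H := H) using 1
  ext T
  simp

theorem isConvexTransitiveFor_calkinAlgebra :
    IsConvexTransitiveFor (CalkinAlgebra H) (calkinSeparableSubspaceTopology H) := by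
  intro q hq
  refine Set.Subset.antisymm ?_ ?_
  · exact @closure_minimal _ (calkinSeparableSubspaceTopology H) _ _
      (convexHull_isometryOrbit_subset_closedBall hq) isClosed_closedBall_calkinAlgebra
  intro p hp
  obtain ⟨T, rfl⟩ := (compactOp H).mkQ_surjective q
  obtain ⟨S, rfl⟩ := (compactOp H).mkQ_surjective p
  rw [mem_closedBall_zero_iff] at hp
  refine (@mem_closure_iff _ (calkinSeparableSubspaceTopology H) _ _).2 fun O hO hSO => ?_
  obtain ⟨s, ε, hs, hε, hsW⟩ := exists_isSeparable_of_isOpen (isOpen_coinduced.1 hO) hSO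
  set Y := (Submodule.span ℂ s).topologicalClosure
  have hYsep : TopologicalSpace.SeparableSpace Y :=
    (hs.span (R := ℂ)).closure.separableSpace
  have : CompleteSpace Y := (Submodule.isClosed_topologicalClosure _).completeSpace_coe
  obtain ⟨w, b, -⟩ := exists_hilbertBasis ℂ Y
  have hw : Countable w := b.orthonormal.countable_of_separableSpace
  -- The projection onto `Y` factors through `ℓ²` of a countable Hilbert basis.
  set F : EllTwo w →L[ℂ] H := Y.subtypeL ∘L (b.repr.symm : EllTwo w →L[ℂ] Y)
  set Q : H →L[ℂ] EllTwo w := (b.repr : Y →L[ℂ] EllTwo w) ∘L Y.orthogonalProjectionOnto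
  have hFQ : F ∘L Q = spanProj s := by
    ext x
    simp [F, Q]
    rfl
  have hF : ‖F‖ ≤ 1 := ContinuousLinearMap.opNorm_le_bound _ zero_le_one fun a => by
    rw [one_mul]
    exact (b.repr.symm.norm_map a).le
  have hQ : ‖Q‖ ≤ 1 := ContinuousLinearMap.opNorm_le_bound _ zero_le_one fun a => by
    simpa [Q] using Y.norm_orthogonalProjectionOnto_apply_le a
  have hSP := mkQ_mul_mem_closure_convexHull (J := compactOp H)
    (fun A T hT => mul_mem_compactOp_left A hT) (fun A T hT => mul_mem_compactOp_right A hT)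
    (T := T) (P := spanProj s) (S := S) (fun ε hε => hFQ ▸ exists_mul_mul_sub_le
      (fun A T hT => mul_mem_compactOp_right A hT) (fun A T hT => mul_mem_compactOp_left A hT)
      (le_refl ℵ₀) (fun T s hs =>
        mul_spanProj_mem_compactOp T (Cardinal.lt_aleph0_iff_set_finite.1 hs))
      hq (Cardinal.mk_le_aleph0_iff.2 hw) hF hQ hε) hp
  obtain ⟨r, hr, hdist⟩ := Metric.mem_closure_iff.1 hSP ε hε
  rw [dist_comm, dist_eq_norm] at hdist
  -- Lifting the difference with norm below `ε` gives a representative of `r` that is `ε`-close to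
  -- `S` on `s`, where `spanProj s` is the identity.
  obtain ⟨m, hm, hm'⟩ := Submodule.Quotient.norm_mk_lt (r - (compactOp H).mkQ (S * spanProj s))
    (sub_pos.2 hdist)
  have hrm : (compactOp H).mkQ (S * spanProj s + m) = r := by
    rw [map_add, Submodule.mkQ_apply _ m, hm]
    abel
  refine ⟨r, ?_, hr⟩
  rw [← hrm]
  refine hsW _ fun y hy => ?_
  have e : S y - (S * spanProj s + m) y = -(m y) := by
    change S y - (S (spanProj s y) + m y) = _
    rw [spanProj_apply_of_mem hy]
    abel
  rw [e, norm_neg]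
  refine (m.le_opNorm y).trans ?_
  gcongr
  linarith

theorem isConvexTransitive_modSeparableRange {ι : Type u} (b : HilbertBasis ι ℂ H)
    (hι : #ι ≤ ℵ₁) : IsConvexTransitive (ModSeparableRange H) := by
  intro q hq
  refine Set.Subset.antisymm (closure_minimal (convexHull_isometryOrbit_subset_closedBall hq)
    Metric.isClosed_closedBall) ?_
  intro p hp
  obtain ⟨T, rfl⟩ := (separableRangeOp H).mkQ_surjective q
  obtain ⟨S, rfl⟩ := (separableRangeOp H).mkQ_surjective p
  rw [mem_closedBall_zero_iff] at hp
  set F : EllTwo ι →L[ℂ] H := (b.repr.symm : EllTwo ι →L[ℂ] H)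
  set Q : H →L[ℂ] EllTwo ι := (b.repr : H →L[ℂ] EllTwo ι)
  have hFQ : F ∘L Q = 1 := by
    ext x
    simp [F, Q]
  have hF : ‖F‖ ≤ 1 := ContinuousLinearMap.opNorm_le_bound _ zero_le_one fun a => by simp [F]
  have hQ : ‖Q‖ ≤ 1 := ContinuousLinearMap.opNorm_le_bound _ zero_le_one fun a => by simp [Q]
  have h := mkQ_mul_mem_closure_convexHull (J := separableRangeOp H)
    (fun A T hT => mul_mem_separableRangeOp_left A hT)
    (fun A T hT => mul_mem_separableRangeOp_right A hT)
    (T := T) (P := 1) (S := S) (fun ε hε => hFQ ▸ exists_mul_mul_sub_le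
      (fun A T hT => mul_mem_separableRangeOp_right A hT)
      (fun A T hT => mul_mem_separableRangeOp_left A hT)
      (Cardinal.aleph0_le_aleph 1) (fun T s hs => mul_spanProj_mem_separableRangeOp T
        (Cardinal.le_aleph0_iff_set_countable.1 (Cardinal.lt_aleph_one_iff.1 hs)))
      hq hι hF hQ hε) hp
  rwa [mul_one] at h

end Main

theorem mainTheorem3 :
    (∀ Γ : Type u, #Γ = ℵ₁ → IsConvexTransitive (ModSeparableRange (EllTwo Γ))) ∧
      (∀ (κ : Cardinal.{v}), ℵ₀ ≤ κ → ∀ Γ : Type v, #Γ = κ →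
        IsConvexTransitiveFor (CalkinAlgebra (EllTwo Γ))
          (calkinSeparableSubspaceTopology (EllTwo Γ))) :=
  ⟨fun _ hΓ => isConvexTransitive_modSeparableRange (.ofRepr (.refl ℂ _)) hΓ.le,
    fun _ _ _ _ => isConvexTransitiveFor_calkinAlgebra⟩
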